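/- Let $C_1\in\{1,-1\}$ and $C_2>0$. For $L\ge 0$, an $H^2$-solution on $[0,L]$ of one of the initial value problems below is a function in $C([0,L],H^2(\mathbb R))\cap C^1([0,L],L^2(\mathbb R))$ (functions of $z\in[0,L]$ with values in spaces of complex-valued functions of $t\in\mathbb R$) that takes the given initial value at $z=0$ and satisfies the equation in $L^2(\mathbb R)$ for every $z\in[0,L]$; such a function also belongs to $L^\infty([0,L],H^2(\mathbb R))$. For every $\varepsilon>0$ there exists $L(\varepsilon)>0$ such that for every $L\in[0,L(\varepsilon)]$ there exists $\delta>0$, depending only on $\varepsilon$, $L$ (and $C_1,C_2$), with the following property. Let $v_0\in H^2(\mathbb R)$ be such that $t^2v_0$ and $t\,\partial_t v_0$ belong to $L^2(\mathbb R)$, let $v$ be an $H^2$-solution on $[0,L]$ of $$iv_z+v_{tt}+C_1e^{-C_2z}|v|^2v+\tfrac{C_2^2}{4}t^2v=0,\qquad v(0)=v_0,$$ and let $u$ be an $H^2$-solution on $[0,L]$ of $$iu_z+u_{tt}+C_1e^{-C_2z}|u|^2u=0,\qquad u(0)=v_0.$$ If $\|t^2v(0)\|_{L^2}<\delta$ and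 $\|t\,v_t(0)\|_{L^2}<\delta$, then $\|v(z)-u(z)\|_{L^2}<\varepsilon$ for every $z\in[0,L]$. -/

import Mathlib

open MeasureTheory Set
open scoped ContDiff ENNReal

/-- The Hilbert space `L²(ℝ)` of (classes of) complex-valued functions. -/
abbrev L2 : Type := Lp ℂ 2 (volume : Measure ℝ)

/-- `g` is the `k`-th weak derivative of `f`:
`∫ g φ = (-1)^k ∫ f D^k φ` for all test functions `φ`. -/
def HasWeakDeriv (k : ℕ) (f g : L2) : Prop :=
  ∀ φ : ℝ → ℂ, ContDiff ℝ ∞ φ → HasCompactSupport φ →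
    ∫ t, g t * φ t = (-1) ^ k * ∫ t, f t * iteratedDeriv k φ t

theorem L2.integrable_mul_test (f : L2) {φ : ℝ → ℂ} (hφ : Continuous φ)
    (hc : HasCompactSupport φ) : Integrable (fun t => f t * φ t) :=
  have h : MemLp φ 2 volume := hφ.memLp_of_hasCompactSupport hc
  (Lp.memLp f).integrable_mul h

theorem HasCompactSupport.iteratedDeriv_complex {φ : ℝ → ℂ} (hc : HasCompactSupport φ) (k : ℕ) :
    HasCompactSupport (iteratedDeriv k φ) := by
  induction k with
  | zero => simpa using hc
  | succ k ih => rw [iteratedDeriv_succ]; exact ih.deriv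

theorem L2.integrable_mul_iteratedDeriv (f : L2) {φ : ℝ → ℂ} (hφ : ContDiff ℝ ∞ φ)
    (hc : HasCompactSupport φ) (k : ℕ) : Integrable (fun t => f t * iteratedDeriv k φ t) :=
  f.integrable_mul_test (hφ.continuous_iteratedDeriv k (by exact_mod_cast le_top))
    (hc.iteratedDeriv_complex k)

theorem L2.integral_add_mul (f g : L2) {ψ : ℝ → ℂ} (hf : Integrable (fun t => f t * ψ t))
    (hg : Integrable (fun t => g t * ψ t)) :
    ∫ t, (f + g : L2) t * ψ t = (∫ t, f t * ψ t) + ∫ t, g t * ψ t := by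
  rw [← integral_add hf hg]
  refine integral_congr_ae ?_
  filter_upwards [Lp.coeFn_add f g] with t ht
  rw [ht, Pi.add_apply, add_mul]

theorem L2.integral_smul_mul (c : ℂ) (f : L2) (ψ : ℝ → ℂ) :
    ∫ t, (c • f : L2) t * ψ t = c * ∫ t, f t * ψ t := by
  rw [← integral_const_mul]
  refine integral_congr_ae ?_
  filter_upwards [Lp.coeFn_smul c f] with t ht
  rw [ht, Pi.smul_apply, smul_eq_mul, mul_assoc]

theorem HasWeakDeriv.add {k : ℕ} {f g f' g' : L2} (h : HasWeakDeriv k f g)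
    (h' : HasWeakDeriv k f' g') : HasWeakDeriv k (f + f') (g + g') := by
  intro φ hφ hc
  rw [L2.integral_add_mul _ _ (g.integrable_mul_test hφ.continuous hc)
      (g'.integrable_mul_test hφ.continuous hc),
    L2.integral_add_mul _ _ (f.integrable_mul_iteratedDeriv hφ hc k)
      (f'.integrable_mul_iteratedDeriv hφ hc k), h φ hφ hc, h' φ hφ hc, mul_add]

theorem HasWeakDeriv.smul {k : ℕ} {f g : L2} (c : ℂ) (h : HasWeakDeriv k f g) :
    HasWeakDeriv k (c • f) (c • g) := by
  intro φ hφ hc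
  rw [L2.integral_smul_mul, L2.integral_smul_mul, h φ hφ hc]
  ring

theorem HasWeakDeriv.zero (k : ℕ) : HasWeakDeriv k 0 0 := by
  have h (ψ : ℝ → ℂ) : ∫ t, (0 : L2) t * ψ t = 0 := by
    simp
  intro φ _ _
  rw [h, h, mul_zero]

/-- The Sobolev space `H^m(ℝ)`. An element is represented by the tuple
`(u, Du, …, D^m u)` of an `L²` function together with its weak derivatives (which `u` determines),
so that the norm inherited from the `ℓ²`-product is `(∑_{k ≤ m} ‖D^k u‖²_{L²})^{1/2}`. -/
def Hm (m : ℕ) : Submodule ℂ (PiLp 2 (fun _ : Fin (m + 1) => L2)) where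
  carrier := {u | ∀ k : Fin (m + 1), HasWeakDeriv k (u 0) (u k)}
  add_mem' := by
    intro u v hu hv k
    exact (hu k).add (hv k)
  zero_mem' := by
    intro k
    exact HasWeakDeriv.zero k
  smul_mem' := by
    intro c u hu k
    exact (hu k).smul c

/-- The weak derivative `D^k u ∈ L²(ℝ)` of `u ∈ H^m(ℝ)`, for `k ≤ m`; `u.D 0` is `u` itself. -/
def Hm.D {m : ℕ} (k : Fin (m + 1)) (u : Hm m) : L2 := (u : PiLp 2 (fun _ : Fin (m + 1) => L2)) k

/-- `v` is an `H²`-solution on `I = [0, L]` of the initial value problem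
`i v_z + v_tt + g(z, t, v) = 0`, `v(0) = φ`: `v ∈ C(I, H²(ℝ)) ∩ C¹(I, L²(ℝ))`, and the equation
holds for every `z ∈ I` as an identity of (classes of) functions of `t`.
The function `vz` is the derivative `v_z : I → L²(ℝ)`. -/
structure IsH2Solution (L : ℝ) (g : ℝ → ℝ → ℂ → ℂ) (φ : Hm 2) (v : ℝ → Hm 2) : Prop where
  continuousOn : ContinuousOn v (Icc 0 L)
  initial : v 0 = φ
  exists_deriv : ∃ vz : ℝ → L2, ContinuousOn vz (Icc 0 L) ∧
    (∀ z ∈ Icc 0 L, HasDerivWithinAt (fun y => Hm.D 0 (v y)) (vz z) (Icc 0 L) z) ∧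
    ∀ z ∈ Icc 0 L, ∀ᵐ t : ℝ,
      Complex.I * vz z t + Hm.D 2 (v z) t + g z t (Hm.D 0 (v z) t) = 0

/-- The nonlinearity of the lossy NLSE `i u_z + u_tt + C₁ e^{-C₂ z} |u|² u = 0`. -/
noncomputable def nlseTerm (C₁ C₂ : ℝ) (z _t : ℝ) (w : ℂ) : ℂ :=
  ((C₁ * Real.exp (-C₂ * z) * ‖w‖ ^ 2 : ℝ) : ℂ) * w

/-- The zeroth-order terms of the transformed NLSE
`i v_z + v_tt + C₁ e^{-C₂ z} |v|² v + (C₂² / 4) t² v = 0`. -/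
noncomputable def tnlseTerm (C₁ C₂ : ℝ) (z t : ℝ) (w : ℂ) : ℂ :=
  ((C₁ * Real.exp (-C₂ * z) * ‖w‖ ^ 2 : ℝ) : ℂ) * w + ((C₂ ^ 2 / 4 * t ^ 2 : ℝ) : ℂ) * w

/-!
The weight in the smallness condition controls the solution itself. For `w ∈ H¹(ℝ)` with
`t w_t ∈ L²(ℝ)`, integrating `(t |w|²)' = |w|² + 2 Re (conj w · t w_t)` over the line gives
`‖w‖² ≤ 2 ‖w‖ ‖t w_t‖`, hence `‖w‖ ≤ 2 ‖t w_t‖` (`HasWeakDeriv.norm_le_two_mul_norm`). So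
`‖t v_t(0)‖ < δ` forces the common initial value to have `L²` norm below `2 δ`. Both equations
conserve the `L²` norm, because `⟪v, v_tt⟫` is real and the remaining terms multiply the unknown by
a real factor (`IsH2Solution.norm_eq`). Therefore `‖v(z) - u(z)‖ ≤ 2 ‖v₀‖ < 4 δ` for every `z`.

Both facts rest on integration by parts for functions with weak derivatives in `L²`. Such a function
has an absolutely continuous representative (`HasWeakDeriv.exists_isPrimitive`, by the
Du Bois-Reymond lemma), products of such representatives obey the product rule
(`IsPrimitive.mul`), and the boundary terms vanish along a sequence of growing intervals
(`IsPrimitive.integral_eq_zero`).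
-/

open Filter ComplexConjugate

/-! ### Primitives of locally integrable functions -/

/-- `F` is an absolutely continuous function with almost everywhere derivative `f`, encoded by the
fundamental theorem of calculus: `f` is locally integrable and `∫_a^b f = F b - F a` for all
`a`, `b`. -/
structure IsPrimitive (F f : ℝ → ℂ) : Prop where
  locallyIntegrable : LocallyIntegrable f
  integral_eq_sub : ∀ a b, ∫ x in a..b, f x = F b - F a

namespace IsPrimitive

variable {F G f g : ℝ → ℂ}

theorem of_contDiff (hF : ContDiff ℝ 1 F) : IsPrimitive F (deriv F) where
  locallyIntegrable := (hF.continuous_deriv le_rfl).locallyIntegrable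
  integral_eq_sub a b :=
    intervalIntegral.integral_deriv_eq_sub (fun x _ => (hF.differentiable one_ne_zero) x)
      ((hF.continuous_deriv le_rfl).intervalIntegrable a b)

theorem of_locallyIntegrable (hg : LocallyIntegrable g) (c : ℂ) :
    IsPrimitive (fun x => c + ∫ y in (0 : ℝ)..x, g y) g where
  locallyIntegrable := hg
  integral_eq_sub a b := by
    rw [add_sub_add_left_eq_sub, intervalIntegral.integral_interval_sub_left]
    · exact (hg.integrableOn_isCompact isCompact_uIcc).intervalIntegrable
    · exact (hg.integrableOn_isCompact isCompact_uIcc).intervalIntegrable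

theorem intervalIntegrable (h : IsPrimitive F f) (a b : ℝ) : IntervalIntegrable f volume a b :=
  (h.locallyIntegrable.integrableOn_isCompact isCompact_uIcc).intervalIntegrable

theorem eq_add_integral (h : IsPrimitive F f) (a : ℝ) :
    F = fun x => F a + ∫ y in a..x, f y := by
  ext x
  rw [h.integral_eq_sub]
  ring

/-- The real and imaginary parts are treated separately, because absolute continuity of the
indefinite integral is available for real-valued integrands. -/
theorem absolutelyContinuousOnInterval (h : IsPrimitive F f) (a b : ℝ) :
    AbsolutelyContinuousOnInterval F a b := by
  have hc : ∀ c : ℂ, AbsolutelyContinuousOnInterval (fun _ : ℝ => c) a b := fun c =>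
    (contDiff_const.contDiffOn).absolutelyContinuousOnInterval
  have hint := h.intervalIntegrable a b
  have hre : IntervalIntegrable (fun x => (f x).re) volume a b := ⟨hint.1.re, hint.2.re⟩
  have him : IntervalIntegrable (fun x => (f x).im) volume a b := ⟨hint.1.im, hint.2.im⟩
  have e : F = fun x => F a + ((∫ y in a..x, (f y).re) • (1 : ℂ)
      + (∫ y in a..x, (f y).im) • Complex.I) := by
    ext x
    have hx := h.intervalIntegrable a x
    have h1 : ∫ y in a..x, (f y).re = (F x - F a).re := by
      rw [← h.integral_eq_sub]
      exact Complex.reCLM.intervalIntegral_comp_comm hx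
    have h2 : ∫ y in a..x, (f y).im = (F x - F a).im := by
      rw [← h.integral_eq_sub]
      exact Complex.imCLM.intervalIntegral_comp_comm hx
    rw [h1, h2, Complex.real_smul, Complex.real_smul, mul_one, Complex.re_add_im]
    ring
  rw [e]
  exact (hc _).fun_add
    (((hre.absolutelyContinuousOnInterval_intervalIntegral left_mem_uIcc).fun_smul (hc 1)).fun_add
      ((him.absolutelyContinuousOnInterval_intervalIntegral left_mem_uIcc).fun_smul (hc _)))

theorem ae_hasDerivAt (h : IsPrimitive F f) : ∀ᵐ x, HasDerivAt F (f x) x := by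
  rw [h.eq_add_integral 0]
  filter_upwards [LocallyIntegrable.ae_hasDerivAt_integral h.locallyIntegrable] with x hx
  exact (hx 0).const_add _

theorem continuous (h : IsPrimitive F f) : Continuous F := by
  rw [h.eq_add_integral 0]
  exact continuous_const.add
    (intervalIntegral.continuous_primitive (h.intervalIntegrable) 0)

/-- Product rule. The difference of `F G` and the primitive of `f G + F g` is absolutely continuous
with almost everywhere vanishing derivative, hence constant on every interval. -/
theorem mul (hF : IsPrimitive F f) (hG : IsPrimitive G g) :
    IsPrimitive (fun x => F x * G x) (fun x => f x * G x + F x * g x) := by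
  have hloc : LocallyIntegrable (fun x => f x * G x + F x * g x) := by
    refine LocallyIntegrable.add ?_ ?_
    · simpa [mul_comm] using hF.locallyIntegrable.smul_continuous hG.continuous
    · simpa using hG.locallyIntegrable.continuous_smul hF.continuous
  refine ⟨hloc, fun a b => ?_⟩
  have hI := of_locallyIntegrable hloc 0
  obtain ⟨C, hC⟩ := (((hF.absolutelyContinuousOnInterval a b).smul
    (hG.absolutelyContinuousOnInterval a b)).sub
      (hI.absolutelyContinuousOnInterval a b)).const_of_ae_hasDerivAt_zero (by
    filter_upwards [hF.ae_hasDerivAt, hG.ae_hasDerivAt, hI.ae_hasDerivAt] with x h1 h2 h3 _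
    convert! (h1.mul h2).sub h3 using 1
    ring)
  have ha := hC a left_mem_uIcc
  have hb := hC b right_mem_uIcc
  rw [hI.integral_eq_sub]
  simp only [Pi.sub_apply, smul_eq_mul, Pi.mul_apply] at ha hb
  linear_combination ha - hb

theorem star (h : IsPrimitive F f) : IsPrimitive (fun x => conj (F x)) (fun x => conj (f x)) where
  locallyIntegrable x := by
    obtain ⟨s, hs, hi⟩ := h.locallyIntegrable x
    exact ⟨s, hs, Complex.conjCLE.toContinuousLinearMap.integrable_comp hi⟩
  integral_eq_sub a b := by
    have := Complex.conjCLE.toContinuousLinearMap.intervalIntegral_comp_comm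
      (h.intervalIntegrable a b)
    have h2 := h.integral_eq_sub a b
    simp at this
    rw [this, h2, map_sub]

theorem ofReal : IsPrimitive (fun x : ℝ => (x : ℂ)) (fun _ => 1) where
  locallyIntegrable := continuous_const.locallyIntegrable
  integral_eq_sub a b := by simp

/-- An integrable `f` with primitive `F` has total integral zero as soon as `|F x| ≤ |x| Q x` for
large `|x|`, with `Q` integrable. No decay of `F` is assumed: were the integral nonzero, then
`R (Q R + Q (-R))` would be bounded below for large `R`, and `1 / R` would be integrable at
infinity. The weight `|x|` makes room for the boundary term `t |F|²` of functions `F` that are only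
square integrable. -/
theorem integral_eq_zero (h : IsPrimitive F f) (hf : Integrable f) {Q : ℝ → ℝ}
    (hQ : Integrable Q) (hFQ : ∀ x, 1 ≤ |x| → ‖F x‖ ≤ |x| * Q x) : ∫ x, f x = 0 := by
  by_contra hne
  have hlim : Tendsto (fun R : ℝ => ‖∫ x in (-R)..R, f x‖) atTop (nhds ‖∫ x, f x‖) :=
    (intervalIntegral_tendsto_integral hf tendsto_neg_atTop_atBot tendsto_id).norm
  have hpos : 0 < ‖∫ x, f x‖ := norm_pos_iff.mpr hne
  set η := ‖∫ x, f x‖ / 2 with hη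
  obtain ⟨N, hN⟩ := eventually_atTop.mp (hlim.eventually_const_lt (half_lt_self hpos))
  refine not_integrableOn_Ioi_inv (a := max N 1) ?_
  have hdom : Integrable (fun R => η⁻¹ * (Q R + Q (-R))) := (hQ.add hQ.comp_neg).const_mul _
  refine hdom.integrableOn.mono' measurable_inv.aestronglyMeasurable ?_
  refine (ae_restrict_iff' measurableSet_Ioi).mpr (Eventually.of_forall fun R hR => ?_)
  have hR : N < R ∧ 1 < R := max_lt_iff.mp hR
  have hR0 : 0 < R := by linarith
  have h1 := hN R hR.1.le
  have h2 := hFQ R (by rw [abs_of_pos hR0]; exact hR.2.le)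
  have h3 := hFQ (-R) (by rw [abs_neg, abs_of_pos hR0]; exact hR.2.le)
  rw [abs_neg, abs_of_pos hR0] at h3
  rw [abs_of_pos hR0] at h2
  rw [h.integral_eq_sub] at h1
  have h4 := norm_sub_le (F R) (F (-R))
  have hη0 : 0 < η := half_pos hpos
  rw [Real.norm_of_nonneg (inv_nonneg.mpr hR0.le), inv_mul_eq_div, le_div_iff₀ hη0,
    inv_mul_eq_div, div_le_iff₀ hR0]
  linarith

end IsPrimitive

/-! ### Functions with vanishing weak derivative -/

/-- A test function with integral zero is the derivative of a test function. -/
theorem exists_contDiff_hasCompactSupport_deriv_eq {θ : ℝ → ℂ} (hθ : ContDiff ℝ ∞ θ)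
    (hc : HasCompactSupport θ) (h0 : ∫ x, θ x = 0) :
    ∃ φ : ℝ → ℂ, ContDiff ℝ ∞ φ ∧ HasCompactSupport φ ∧ deriv φ = θ := by
  obtain ⟨R, hR⟩ := hc.isCompact.isBounded.subset_closedBall 0
  have hz : ∀ x, R < |x| → θ x = 0 := fun x hx => by
    by_contra hne
    have := hR (subset_tsupport θ hne)
    rw [Metric.mem_closedBall, dist_zero_right, Real.norm_eq_abs] at this
    linarith
  have hint : Integrable θ := hθ.continuous.integrable_of_hasCompactSupport hc
  have hd : ∀ x, HasDerivAt (fun x => ∫ y in Iic x, θ y) (θ x) x := fun x => by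
    have h1 : (fun x => ∫ y in Iic x, θ y) =
        fun x => (∫ y in Iic (0 : ℝ), θ y) + ∫ y in (0 : ℝ)..x, θ y := by
      ext x
      rw [← intervalIntegral.integral_Iic_sub_Iic hint.integrableOn hint.integrableOn]
      ring
    rw [h1]
    exact (hθ.continuous.integral_hasStrictDerivAt 0 x).hasDerivAt.const_add _
  have hder : deriv (fun x => ∫ y in Iic x, θ y) = θ := funext fun x => (hd x).deriv
  refine ⟨fun x => ∫ y in Iic x, θ y, ?_, ?_, hder⟩
  · rw [contDiff_infty_iff_deriv, hder]
    exact ⟨fun x => (hd x).differentiableAt, hθ⟩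
  · refine HasCompactSupport.intro (isCompact_closedBall (0 : ℝ) R) fun x hx => ?_
    rw [Metric.mem_closedBall, dist_zero_right, Real.norm_eq_abs, not_le] at hx
    rcases lt_abs.mp hx with hx | hx
    · have h2 : ∫ y in Ioi x, θ y = 0 := setIntegral_eq_zero_of_forall_eq_zero fun y hy =>
        hz y (lt_of_lt_of_le (hx.trans hy) (le_abs_self y))
      have h3 := intervalIntegral.integral_Iic_add_Ioi (b := x) hint.integrableOn hint.integrableOn
      rw [h2, h0, add_zero] at h3
      exact h3
    · refine setIntegral_eq_zero_of_forall_eq_zero fun y (hy : y ≤ x) => hz y ?_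
      exact lt_of_lt_of_le hx ((neg_le_neg hy).trans (neg_le_abs y))

/-- **Du Bois-Reymond lemma**: a locally integrable function with vanishing weak derivative is almost
everywhere constant. -/
theorem ae_eq_const_of_integral_mul_deriv_eq_zero {w : ℝ → ℂ} (hw : LocallyIntegrable w)
    (h : ∀ φ : ℝ → ℂ, ContDiff ℝ ∞ φ → HasCompactSupport φ → ∫ x, w x * deriv φ x = 0) :
    ∃ c : ℂ, ∀ᵐ x, w x = c := by
  let χ : ContDiffBump (0 : ℝ) := ⟨1, 2, one_pos, one_lt_two⟩
  have hw_mul : ∀ ψ : ℝ → ℂ, Continuous ψ → HasCompactSupport ψ →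
      Integrable fun x => w x * ψ x := fun ψ h1 h2 => by
    simpa [mul_comm] using hw.integrable_smul_left_of_hasCompactSupport h1 h2
  let X : ℝ → ℂ := fun x => (χ.normed volume x : ℂ)
  have hX : ContDiff ℝ ∞ X := Complex.ofRealCLM.contDiff.comp χ.contDiff_normed
  have hXc : HasCompactSupport X := χ.hasCompactSupport_normed.comp_left Complex.ofReal_zero
  have hX1 : ∫ x, X x = 1 := by
    rw [integral_complex_ofReal, χ.integral_normed, Complex.ofReal_one]
  refine ⟨∫ x, w x * X x, ae_eq_of_integral_contDiff_smul_eq hw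
    continuous_const.locallyIntegrable fun ψ hψ hψc => ?_⟩
  let Ψ : ℝ → ℂ := fun x => (ψ x : ℂ)
  have hΨ : ContDiff ℝ ∞ Ψ := Complex.ofRealCLM.contDiff.comp hψ
  have hΨc : HasCompactSupport Ψ := hψc.comp_left Complex.ofReal_zero
  set m : ℂ := ∫ x, Ψ x with hm
  -- Subtracting a multiple of the normalized bump turns `Ψ` into the derivative of a test function,
  -- so that `∫ w Ψ = (∫ w X) ∫ Ψ`.
  obtain ⟨φ, hφ, hφc, hφd⟩ := exists_contDiff_hasCompactSupport_deriv_eq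
    (θ := fun x => Ψ x - m * X x) (hΨ.sub (contDiff_const.mul hX))
    (hΨc.sub (hXc.mul_left (f := fun _ => m))) (by
      rw [integral_sub (hΨ.continuous.integrable_of_hasCompactSupport hΨc)
        ((hX.continuous.integrable_of_hasCompactSupport hXc).const_mul m),
        integral_const_mul, hX1, mul_one, sub_self])
  have key := h φ hφ hφc
  have e : ∀ x, w x * deriv φ x = w x * Ψ x - m * (w x * X x) := fun x => by
    rw [hφd]; ring
  simp_rw [e] at key
  rw [integral_sub (hw_mul Ψ hΨ.continuous hΨc) ((hw_mul X hX.continuous hXc).const_mul m),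
    integral_const_mul, sub_eq_zero] at key
  simp_rw [Complex.real_smul]
  rw [integral_mul_const, ← hm, ← key]
  exact integral_congr_ae (Eventually.of_forall fun x => mul_comm _ _)

/-! ### Integration by parts for weak derivatives -/

theorem L2.locallyIntegrable (f : L2) : LocallyIntegrable f :=
  (Lp.memLp f).locallyIntegrable one_le_two

/-- An `L²` function with weak derivative `g ∈ L²` has an absolutely continuous representative with
almost everywhere derivative `g`. -/
theorem HasWeakDeriv.exists_isPrimitive {f g : L2} (h : HasWeakDeriv 1 f g) :
    ∃ F : ℝ → ℂ, f =ᵐ[volume] F ∧ IsPrimitive F g := by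
  have hF := IsPrimitive.of_locallyIntegrable g.locallyIntegrable 0
  -- The indefinite integral of `g` has weak derivative `g` too, so it differs from `f` by a constant.
  set F : ℝ → ℂ := fun x => 0 + ∫ y in (0 : ℝ)..x, g y
  obtain ⟨c, hc⟩ := ae_eq_const_of_integral_mul_deriv_eq_zero (w := fun x => f x - F x)
    (f.locallyIntegrable.sub hF.continuous.locallyIntegrable) fun φ hφ hφc => by
      have hd : Continuous (deriv φ) := hφ.continuous_deriv (by exact_mod_cast le_top)
      have hi1 : Integrable fun x => F x * deriv φ x :=
        (hF.continuous.mul hd).integrable_of_hasCompactSupport hφc.deriv.mul_left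
      have hi2 := f.integrable_mul_test hd hφc.deriv
      have hi3 := g.integrable_mul_test hφ.continuous hφc
      have hi4 : Integrable fun x => F x * φ x :=
        (hF.continuous.mul hφ.continuous).integrable_of_hasCompactSupport hφc.mul_left
      have h1 := (hF.mul (.of_contDiff (hφ.of_le (by exact_mod_cast le_top)))).integral_eq_zero
        (hi3.add hi1) hi4.norm fun x hx => le_mul_of_one_le_left (norm_nonneg _) hx
      have h2 := h φ hφ hφc
      rw [integral_add hi3 hi1] at h1
      simp only [iteratedDeriv_one, pow_one, neg_one_mul] at h2
      simp_rw [sub_mul]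
      rw [integral_sub hi2 hi1]
      linear_combination -h1 + h2
  refine ⟨fun x => c + ∫ y in (0 : ℝ)..x, g y, ?_, .of_locallyIntegrable g.locallyIntegrable c⟩
  filter_upwards [hc] with x hx
  simp only [F, zero_add] at hx
  rw [← hx]
  ring

/-- Integration by parts in `H¹(ℝ)`: there are no boundary terms. -/
theorem HasWeakDeriv.inner_add_inner {f f' g g' : L2} (hf : HasWeakDeriv 1 f f')
    (hg : HasWeakDeriv 1 g g') : inner ℂ f' g + inner ℂ f g' = 0 := by
  obtain ⟨F, hfF, hF⟩ := hf.exists_isPrimitive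
  obtain ⟨G, hgG, hG⟩ := hg.exists_isPrimitive
  have hi1 := MeasureTheory.L2.integrable_inner (𝕜 := ℂ) f' g
  have hi2 := MeasureTheory.L2.integrable_inner (𝕜 := ℂ) f g'
  rw [MeasureTheory.L2.inner_def, MeasureTheory.L2.inner_def, ← integral_add hi1 hi2]
  have hp : (fun x => conj (f' x) * G x + conj (F x) * g' x) =ᵐ[volume]
      fun x => inner ℂ (f' x) (g x) + inner ℂ (f x) (g' x) := by
    filter_upwards [hfF, hgG] with x h1 h2
    rw [RCLike.inner_apply, RCLike.inner_apply, h1, h2]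
    ring
  have hQ : Integrable fun x => ‖conj (F x) * G x‖ := by
    refine ((MeasureTheory.L2.integrable_inner (𝕜 := ℂ) f g).congr ?_).norm
    filter_upwards [hfF, hgG] with x h1 h2
    rw [RCLike.inner_apply, h1, h2, mul_comm]
  rw [← integral_congr_ae hp]
  exact (hF.star.mul hG).integral_eq_zero ((hi1.add hi2).congr hp.symm) hQ
    fun x hx => le_mul_of_one_le_left (norm_nonneg _) hx

/-- The uncertainty inequality `‖f‖ ≤ 2 ‖t f'‖`, from `0 = ∫ (t |f|²)' = ‖f‖² + 2 Re ⟪f, t f'⟫`.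
Here `T` is the class of `t f'` in `L²(ℝ)`; nothing is assumed about `t f`. -/
theorem HasWeakDeriv.norm_le_two_mul_norm {f g T : L2} (h : HasWeakDeriv 1 f g)
    (hT : T =ᵐ[volume] fun t : ℝ => (t : ℂ) * g t) : ‖f‖ ≤ 2 * ‖T‖ := by
  obtain ⟨F, hfF, hF⟩ := h.exists_isPrimitive
  have hi0 := MeasureTheory.L2.integrable_inner (𝕜 := ℂ) f f
  have hi1 := MeasureTheory.L2.integrable_inner (𝕜 := ℂ) T f
  have hi2 := MeasureTheory.L2.integrable_inner (𝕜 := ℂ) f T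
  have key : inner ℂ f f + (inner ℂ T f + inner ℂ f T) = 0 := by
    rw [MeasureTheory.L2.inner_def, MeasureTheory.L2.inner_def, MeasureTheory.L2.inner_def,
      ← integral_add hi1 hi2]
    refine (integral_add hi0 (hi1.add hi2)).symm.trans ?_
    have hp : (fun x : ℝ =>
          1 * (conj (F x) * F x) + (x : ℂ) * (conj (g x) * F x + conj (F x) * g x)) =ᵐ[volume]
        fun x => inner ℂ (f x) (f x) + (inner ℂ (T x) (f x) + inner ℂ (f x) (T x)) := by
      filter_upwards [hfF, hT] with x h1 h2
      rw [RCLike.inner_apply, RCLike.inner_apply, RCLike.inner_apply, h1, h2, map_mul,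
        Complex.conj_ofReal]
      ring
    have hQ : Integrable fun x => ‖conj (F x) * F x‖ := by
      refine (hi0.congr ?_).norm
      filter_upwards [hfF] with x h1
      rw [RCLike.inner_apply, h1, mul_comm]
    refine (integral_congr_ae hp).symm.trans ?_
    refine (IsPrimitive.ofReal.mul (hF.star.mul hF)).integral_eq_zero
      ((hi0.add (hi1.add hi2)).congr hp.symm) hQ fun x _ => ?_
    rw [norm_mul, Complex.norm_real, Real.norm_eq_abs]
  have h1 : ‖f‖ ^ 2 ≤ 2 * ‖T‖ * ‖f‖ := by
    calc ‖f‖ ^ 2 = ‖(inner ℂ f f : ℂ)‖ := by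
          rw [inner_self_eq_norm_sq_to_K]; simp
      _ = ‖inner ℂ T f + inner ℂ f T‖ := by
          rw [eq_neg_of_add_eq_zero_left key, norm_neg]
      _ ≤ ‖T‖ * ‖f‖ + ‖f‖ * ‖T‖ :=
          (norm_add_le _ _).trans (add_le_add (norm_inner_le_norm _ _) (norm_inner_le_norm _ _))
      _ = 2 * ‖T‖ * ‖f‖ := by ring
  by_contra! hlt
  nlinarith [norm_nonneg T]

/-! ### Conservation of the `L²` norm -/

theorem Hm.hasWeakDeriv_one_two (u : Hm 2) : HasWeakDeriv 1 (Hm.D 1 u) (Hm.D 2 u) := by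
  intro φ hφ hc
  have hd : ContDiff ℝ ∞ (deriv φ) := (contDiff_infty_iff_deriv.mp hφ).2
  have h1 := u.2 1 (deriv φ) hd hc.deriv
  have h2 := u.2 2 φ hφ hc
  have e : iteratedDeriv 2 φ = iteratedDeriv 1 (deriv φ) := iteratedDeriv_succ'
  simp only [Fin.val_one, Fin.val_two, e, pow_one, iteratedDeriv_one] at h1 h2 ⊢
  change ∫ t, (u : PiLp 2 (fun _ : Fin 3 => L2)) 2 t * φ t
    = -1 * ∫ t, (u : PiLp 2 (fun _ : Fin 3 => L2)) 1 t * deriv φ t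
  rw [h1, h2]
  ring

/-- `⟪u, u''⟫ = -‖u'‖²` is real. -/
theorem Hm.im_inner_D_two (u : Hm 2) : (inner ℂ (Hm.D 0 u) (Hm.D 2 u)).im = 0 := by
  have h := HasWeakDeriv.inner_add_inner (u.2 1) (hasWeakDeriv_one_two u)
  have h1 : (inner ℂ (Hm.D 1 u) (Hm.D 1 u)).im = 0 := inner_self_im (𝕜 := ℂ) _
  have h2 := congrArg Complex.im h
  rw [Complex.add_im] at h2
  change (inner ℂ (Hm.D 1 u) (Hm.D 1 u)).im + _ = _ at h2
  rw [h1, zero_add] at h2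
  exact h2

/-- Conservation of the `L²` norm, for a zeroth-order term that multiplies the unknown by a real
factor. -/
theorem IsH2Solution.norm_eq {L : ℝ} {g : ℝ → ℝ → ℂ → ℂ} {m : ℝ → ℝ → ℂ → ℝ} {φ : Hm 2}
    {v : ℝ → Hm 2} (hv : IsH2Solution L g φ v) (hg : ∀ z t w, g z t w = (m z t w : ℂ) * w)
    {z : ℝ} (hz : z ∈ Icc 0 L) : ‖Hm.D 0 (v z)‖ = ‖Hm.D 0 φ‖ := by
  obtain ⟨vz, -, hder, heq⟩ := hv.exists_deriv
  -- Pointwise, `Re (conj v · v_z) = -Im (conj v · v_tt)`: the real factor `m` drops out before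
  -- integration, so `m |v|²` is never integrated.
  have hinner : ∀ y ∈ Icc 0 L, inner ℝ (Hm.D 0 (v y)) (vz y) = 0 := fun y hy => by
    have hi := MeasureTheory.L2.integrable_inner (𝕜 := ℂ) (Hm.D 0 (v y)) (Hm.D 2 (v y))
    have him := integral_im hi
    simp only [RCLike.im_eq_complex_im] at him
    rw [← neg_eq_zero, ← Hm.im_inner_D_two (v y), MeasureTheory.L2.inner_def,
      MeasureTheory.L2.inner_def, ← him, ← integral_neg]
    refine integral_congr_ae ?_
    filter_upwards [heq y hy] with t ht
    have hvz : vz y t =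
        Complex.I * (Hm.D 2 (v y) t + m y t (Hm.D 0 (v y) t) * Hm.D 0 (v y) t) := by
      rw [hg] at ht
      linear_combination -Complex.I * ht + vz y t * Complex.I_sq
    rw [Complex.inner, RCLike.inner_apply, hvz]
    simp
    ring
  have hsq : ∀ y ∈ Icc 0 L, HasDerivWithinAt (fun y => ‖Hm.D 0 (v y)‖ ^ 2) 0 (Icc 0 L) y :=
    fun y hy => by simpa only [hinner y hy, mul_zero] using (hder y hy).norm_sq
  have h0 : (0 : ℝ) ∈ Icc 0 L := ⟨le_rfl, hz.1.trans hz.2⟩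
  have hle := (convex_Icc 0 L).norm_image_sub_le_of_norm_hasDerivWithin_le (C := 0) hsq
    (fun _ _ => by rw [norm_zero]) h0 hz
  rw [zero_mul, norm_le_zero_iff, sub_eq_zero, hv.initial] at hle
  exact (sq_eq_sq₀ (norm_nonneg _) (norm_nonneg _)).mp hle

theorem theorem3p4p2 (C₁ C₂ : ℝ) (hC₁ : C₁ = 1 ∨ C₁ = -1) (hC₂ : 0 < C₂) :
    ∀ ε : ℝ, 0 < ε → ∃ Lε : ℝ, 0 < Lε ∧ ∀ L ∈ Icc (0 : ℝ) Lε, ∃ δ : ℝ, 0 < δ ∧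
      ∀ v₀ : Hm 2,
        MemLp (fun t : ℝ => (t : ℂ) ^ 2 * Hm.D 0 v₀ t) 2 volume →
        MemLp (fun t : ℝ => (t : ℂ) * Hm.D 1 v₀ t) 2 volume →
      ∀ v u : ℝ → Hm 2,
        IsH2Solution L (tnlseTerm C₁ C₂) v₀ v →
        IsH2Solution L (nlseTerm C₁ C₂) v₀ u →
        eLpNorm (fun t : ℝ => (t : ℂ) ^ 2 * Hm.D 0 (v 0) t) 2 volume < ENNReal.ofReal δ →
        eLpNorm (fun t : ℝ => (t : ℂ) * Hm.D 1 (v 0) t) 2 volume < ENNReal.ofReal δ →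
        ∀ z ∈ Icc (0 : ℝ) L, ‖Hm.D 0 (v z) - Hm.D 0 (u z)‖ < ε := by
  intro ε hε
  -- With `δ = ε / 4` both solutions have norm below `2 δ = ε / 2` throughout; the bound does not
  -- depend on `L`, so any positive threshold for `L` serves.
  refine ⟨1, one_pos, fun L _ => ⟨ε / 4, by positivity, ?_⟩⟩
  intro v₀ _ hmem v u hv hu _ hδ z hz
  have hv' : ‖Hm.D 0 (v z)‖ = ‖Hm.D 0 v₀‖ := hv.norm_eq
    (m := fun z t w => C₁ * Real.exp (-C₂ * z) * ‖w‖ ^ 2 + C₂ ^ 2 / 4 * t ^ 2)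
    (fun z t w => by rw [tnlseTerm, ← add_mul, ← Complex.ofReal_add]) hz
  have hu' : ‖Hm.D 0 (u z)‖ = ‖Hm.D 0 v₀‖ := hu.norm_eq
    (m := fun z _ w => C₁ * Real.exp (-C₂ * z) * ‖w‖ ^ 2) (fun _ _ _ => rfl) hz
  have hT : ‖hmem.toLp‖ < ε / 4 := by
    rw [Lp.norm_toLp]
    rw [hv.initial] at hδ
    exact (ENNReal.lt_ofReal_iff_toReal_lt hmem.2.ne).mp hδ
  have h0 : ‖Hm.D 0 v₀‖ ≤ 2 * ‖hmem.toLp‖ :=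
    HasWeakDeriv.norm_le_two_mul_norm (v₀.2 1) hmem.coeFn_toLp
  have := norm_sub_le (Hm.D 0 (v z)) (Hm.D 0 (u z))
  linarith
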